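/- Let $(X,d)$ and $(Y,\delta)$ be non-empty separable complete metric spaces, let $p,q\in[1,+\infty)$ and $C>0$, and suppose that $X$ satisfies the following condition $\mathrm{link}(C)$: for every $\varepsilon>0$ there is $N\ge 1$ such that any $u,v\in X$ with $d(u,v)<C$ admit $r_0,\dots,r_N\in X$ with $r_0=u$, $r_N=v$ and $d(r_{i-1},r_i)<\varepsilon$ for $1\le i\le N$. Notation. For metric spaces $(Z_n,d_n)$, $n\in\mathbb N$, and $r\ge 1$, let $E((Z_n)_{n};r)$ be the equivalence relation on $\prod_n Z_n$ (with the product topology) given by $(x,y)\in E((Z_n)_n;r)\iff\sum_n d_n(x(n),y(n))^r<+\infty$; write $E(Z;r)$ if $Z_n=Z$ for all $n$. For a separable complete metric space $Z$, let $F(Z;r)=E((F_n)_n;r)$, where $F_0\subseteq F_1\subseteq\cdots$ is any sequence of non-empty finite subsets of $Z$ with $\bigcup_n F_n$ dense in $Z$ (the assertion below holds for every choice of such sequences in $X$ and in $Y$). For $y^*\in Y^{\mathbb N}$, let $\ell_q(Y,y^*)$ be the set of $y\in Y^{\mathbb N}$ with $\sum_n\delta(y(n),y^*(n))^q<+\infty$,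 with the metric $\delta_q(x,y)=\left(\sum_n\delta(x(n),y(n))^q\right)^{1/q}$. For $\alpha>0$, $X$ can $C$-finitely Hölder$(\alpha)$ embed into a metric space $(X',d')$ if there are $A,D>0$ such that for every finite $F\subseteq X$ there is $T_F:F\to X'$ with, for all $u,v\in F$: (1) if $d(u,v)\ge C$ then $d'(T_F(u),T_F(v))\ge D$; (2) if $d(u,v)<C$ then $A^{-1}d(u,v)^\alpha\le d'(T_F(u),T_F(v))\le A\,d(u,v)^\alpha$. For relations $R$ on a space $P$ and $S$ on a space $Q$, $R\le_B S$ means that there is a Borel map $\theta:P\to Q$ with $(x,y)\in R\iff(\theta(x),\theta(y))\in S$ for all $x,y\in P$. Then the following conditions are equivalent: (a) $X$ can $C$-finitely Hölder$(p/q)$ embed into $\ell_q(Y,y^*)$ for some $y^*\in Y^{\mathbb N}$; (b) $F(X;p)\le_B E(Y;q)$; (c) $F(X;p)\le_B F(Y;q)$. -/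

import Mathlib

/-- `E` is Borel reducible to `F`: there is a map `θ`, measurable for the Borel σ-algebras of the
two topologies, with `E x y ↔ F (θ x) (θ y)` for all `x, y`. -/
def BorelReducible {α β : Type*} [TopologicalSpace α] [TopologicalSpace β]
    (E : α → α → Prop) (F : β → β → Prop) : Prop :=
  ∃ θ : α → β, @Measurable α β (borel α) (borel β) θ ∧ ∀ x y, E x y ↔ F (θ x) (θ y)

/-- The `ℓ_p`-like relation `E((X_n)_n; p)` on `∏ n, X n`: `∑ d(x n, y n) ^ p < ∞`
(the terms are non-negative, so this is summability). -/
def lpRel (X : ℕ → Type*) [∀ n, PseudoMetricSpace (X n)] (p : ℝ) (x y : ∀ n, X n) : Prop :=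
  Summable fun n => dist (x n) (y n) ^ p

/-- An increasing sequence of (non-empty) finite subsets of `X` with dense union. -/
structure IsFiniteExhaustion {X : Type*} [TopologicalSpace X] (F : ℕ → Set X) : Prop where
  finite : ∀ n, (F n).Finite
  nonempty : (F 0).Nonempty
  mono : Monotone F
  dense : Dense (⋃ n, F n)

/-- The relation `F(X; p) = E((F_n)_n; p)`, computed from the finite exhaustion `F` of `X`;
each `F n` carries the metric of `X`, and `∏ n, F n` the product topology. -/
def finRel {X : Type*} [PseudoMetricSpace X] (F : ℕ → Set X) (p : ℝ) :
    (∀ n, F n) → (∀ n, F n) → Prop :=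
  lpRel (fun n => F n) p

/-- The condition link(C). -/
def Link (X : Type*) [PseudoMetricSpace X] (C : ℝ) : Prop :=
  ∀ ε : ℝ, 0 < ε → ∃ N : ℕ, 1 ≤ N ∧ ∀ u v : X, dist u v < C →
    ∃ r : ℕ → X, r 0 = u ∧ r N = v ∧ ∀ i < N, dist (r i) (r (i + 1)) < ε

/-- `X` can `C`-finitely Hölder(`α`) embed into `X'`. -/
def FinitelyHolderEmbeds (X X' : Type*) [PseudoMetricSpace X] [PseudoMetricSpace X']
    (C α : ℝ) : Prop :=
  ∃ A D : ℝ, 0 < A ∧ 0 < D ∧ ∀ F : Set X, F.Finite → ∃ T : F → X', ∀ u v : F,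
    (C ≤ dist u v → D ≤ dist (T u) (T v)) ∧
    (dist u v < C →
      A⁻¹ * dist u v ^ α ≤ dist (T u) (T v) ∧ dist (T u) (T v) ≤ A * dist u v ^ α)

/-- The underlying set of `ℓ_q((Y_n)_n, y*)`. -/
def LqSpace (Y : ℕ → Type*) [∀ n, PseudoMetricSpace (Y n)] (ystar : ∀ n, Y n) (q : ℝ) :=
  {y : ∀ n, Y n // Summable fun n => dist (y n) (ystar n) ^ q}

namespace LqSpace

variable {Y : ℕ → Type*} [∀ n, PseudoMetricSpace (Y n)] {ystar : ∀ n, Y n} {q : ℝ}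

theorem summable_and_dist_le (hq : 1 ≤ q) (x y z : ∀ n, Y n)
    (hxy : Summable fun n => dist (x n) (y n) ^ q)
    (hyz : Summable fun n => dist (y n) (z n) ^ q) :
    (Summable fun n => dist (x n) (z n) ^ q) ∧
      (∑' n, dist (x n) (z n) ^ q) ^ (1 / q) ≤
        (∑' n, dist (x n) (y n) ^ q) ^ (1 / q) + (∑' n, dist (y n) (z n) ^ q) ^ (1 / q) := by
  obtain ⟨h1, h2⟩ := Real.Lp_add_le_tsum_of_nonneg hq (fun n => dist_nonneg)
    (fun n => dist_nonneg) hxy hyz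
  have hle : ∀ n, dist (x n) (z n) ^ q ≤ (dist (x n) (y n) + dist (y n) (z n)) ^ q := fun n =>
    Real.rpow_le_rpow dist_nonneg (dist_triangle _ _ _) (by linarith)
  have hs : Summable fun n => dist (x n) (z n) ^ q :=
    Summable.of_nonneg_of_le (fun n => Real.rpow_nonneg dist_nonneg _) hle h1
  refine ⟨hs, le_trans ?_ h2⟩
  exact Real.rpow_le_rpow (tsum_nonneg fun n => Real.rpow_nonneg dist_nonneg _)
    (hs.tsum_le_tsum hle h1) (by positivity)

theorem summable_dist (hq : 1 ≤ q) (x y : LqSpace Y ystar q) :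
    Summable fun n => dist (x.1 n) (y.1 n) ^ q :=
  (summable_and_dist_le hq x.1 ystar y.1 x.2 (by simpa only [dist_comm] using y.2)).1

/-- `δ_q(x, y) = (∑ δ_n(x n, y n) ^ q) ^ (1 / q)`. -/
noncomputable instance : Dist (LqSpace Y ystar q) :=
  ⟨fun x y => (∑' n, dist (x.1 n) (y.1 n) ^ q) ^ (1 / q)⟩

noncomputable instance [hq : Fact (1 ≤ q)] : PseudoMetricSpace (LqSpace Y ystar q) where
  dist_self x := by
    have h0 : q ≠ 0 := by linarith [hq.out]
    change (∑' n, dist (x.1 n) (x.1 n) ^ q) ^ (1 / q) = 0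
    simp [Real.zero_rpow h0, h0]
  dist_comm x y := by
    change (∑' n, dist (x.1 n) (y.1 n) ^ q) ^ (1 / q) = (∑' n, dist (y.1 n) (x.1 n) ^ q) ^ (1 / q)
    simp only [dist_comm]
  dist_triangle x y z :=
    (summable_and_dist_le hq.out x.1 y.1 z.1 (summable_dist hq.out x y)
      (summable_dist hq.out y z)).2

end LqSpace

/-!
From a reduction to embeddings: a Borel reduction `θ` of `F(X; p)` to `E(Y; q)` is continuous on a
comeager set. Around a generic sequence `z` there are windows of coordinates such that filling in
`z` on a window makes the part of `θ` on one side of it nearly independent of the entries on the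
other side. Keeping one free coordinate between successive windows splits the `ℓ_q`-sum into blocks,
up to a summable error: `F(X; p)`, on the free coordinates, becomes the summability of `f j u v`,
the `q`-th power of an `ℓ_q`-distance. Repeating suitable pairs of points many times turns the
equivalence of the two summability conditions into inequalities between `f j u v` and `d(u, v) ^ p`
that are uniform in the pair: `f j u v ≤ B * d(u, v) ^ p` for nearby pairs, a bound which chains
extend to all pairs at distance less than `C`, and `min (d(u, v)) C ^ p ≤ B * f j u v` for all
pairs.

Conversely, embed each `F n` by a finite Hölder map into `ℓ_q(Y, y*)`, move the values into finitely
many coordinates and into some `G m` without changing distances by more than a constant factor, and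
write the resulting sequences on disjoint sets of coordinates.
-/

open Filter Topology Set

section LpSum

variable {ι : Type*} {Y : ι → Type*} [∀ i, PseudoMetricSpace (Y i)] {q : ℝ}

/-- The part of the `ℓ_q`-sum `∑ d(x i, y i) ^ q` carried by a finite set of coordinates. The
`q`-th root is not taken, so that sums over disjoint sets of coordinates add up. -/
noncomputable def lpSum (q : ℝ) (s : Finset ι) (x y : ∀ i, Y i) : ℝ :=
  ∑ i ∈ s, dist (x i) (y i) ^ q

theorem dist_rpow_nonneg {Z : Type*} [PseudoMetricSpace Z] (x y : Z) (r : ℝ) : 0 ≤ dist x y ^ r :=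
  Real.rpow_nonneg dist_nonneg r

theorem dist_rpow_le_two_rpow_mul_add {Z : Type*} [PseudoMetricSpace Z] (hq : 0 ≤ q) (x y z : Z) :
    dist x z ^ q ≤ 2 ^ q * (dist x y ^ q + dist y z ^ q) := by
  have hmax : dist x z ≤ 2 * max (dist x y) (dist y z) := by
    linarith [dist_triangle x y z, le_max_left (dist x y) (dist y z),
      le_max_right (dist x y) (dist y z)]
  calc dist x z ^ q ≤ (2 * max (dist x y) (dist y z)) ^ q :=
        Real.rpow_le_rpow dist_nonneg hmax hq
    _ = 2 ^ q * max (dist x y) (dist y z) ^ q :=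
        Real.mul_rpow zero_le_two (le_max_of_le_left dist_nonneg)
    _ ≤ 2 ^ q * (dist x y ^ q + dist y z ^ q) := by
        gcongr
        rcases max_choice (dist x y) (dist y z) with h | h <;> rw [h]
        · exact le_add_of_nonneg_right (dist_rpow_nonneg y z q)
        · exact le_add_of_nonneg_left (dist_rpow_nonneg x y q)

theorem lpSum_nonneg (s : Finset ι) (x y : ∀ i, Y i) : 0 ≤ lpSum q s x y :=
  Finset.sum_nonneg fun _ _ => dist_rpow_nonneg _ _ _

theorem lpSum_self (hq : q ≠ 0) (s : Finset ι) (x : ∀ i, Y i) : lpSum q s x x = 0 :=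
  Finset.sum_eq_zero fun _ _ => by rw [dist_self, Real.zero_rpow hq]

theorem lpSum_comm (s : Finset ι) (x y : ∀ i, Y i) : lpSum q s x y = lpSum q s y x := by
  simp only [lpSum, dist_comm]

theorem lpSum_mono {s t : Finset ι} (hst : s ⊆ t) (x y : ∀ i, Y i) :
    lpSum q s x y ≤ lpSum q t x y :=
  Finset.sum_le_sum_of_subset_of_nonneg hst fun _ _ _ => dist_rpow_nonneg _ _ _

theorem lpSum_le_two_rpow_mul_add (hq : 0 ≤ q) (s : Finset ι) (x y z : ∀ i, Y i) :
    lpSum q s x z ≤ 2 ^ q * (lpSum q s x y + lpSum q s y z) := by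
  simp only [lpSum]
  rw [← Finset.sum_add_distrib, Finset.mul_sum]
  exact Finset.sum_le_sum fun i _ => dist_rpow_le_two_rpow_mul_add hq _ _ _

theorem summable_lpSum_trans {κ : Type*} (hq : 0 ≤ q) {s : κ → Finset ι} {x y z : κ → ∀ i, Y i}
    (hxy : Summable fun k => lpSum q (s k) (x k) (y k))
    (hyz : Summable fun k => lpSum q (s k) (y k) (z k)) :
    Summable fun k => lpSum q (s k) (x k) (z k) :=
  ((hxy.add hyz).mul_left (2 ^ q)).of_nonneg_of_le (fun _ => lpSum_nonneg _ _ _)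
    fun _ => lpSum_le_two_rpow_mul_add hq _ _ _ _

theorem eventually_lpSum_le_of_continuousWithinAt {Z : Type*} [TopologicalSpace Z] (hq : 0 < q)
    {θ : Z → ∀ i, Y i} {H : Set Z} {w : Z} (hθ : ContinuousWithinAt θ H w) (s : Finset ι) {ε : ℝ}
    (hε : 0 < ε) : ∀ᶠ x in 𝓝[H] w, lpSum q s (θ x) (θ w) ≤ ε := by
  have hlim : Tendsto (fun x => lpSum q s (θ x) (θ w)) (𝓝[H] w) (𝓝 (lpSum q s (θ w) (θ w))) :=
    tendsto_finsetSum _ fun i _ =>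
      ((tendsto_pi_nhds.1 hθ i).dist tendsto_const_nhds).rpow_const (Or.inr hq.le)
  rw [lpSum_self hq.ne'] at hlim
  exact hlim.eventually (ge_mem_nhds hε)

end LpSum

theorem eventually_forall_sum_Ico_le {f : ℕ → ℝ} (hf : Summable f) (hf0 : ∀ n, 0 ≤ f n) {ε : ℝ}
    (hε : 0 < ε) : ∀ᶠ l in atTop, ∀ M, ∑ m ∈ Finset.Ico l M, f m ≤ ε := by
  filter_upwards [hf.hasSum.tendsto_sum_nat.eventually (lt_mem_nhds (sub_lt_self _ hε))]
    with l hl M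
  rcases le_total l M with h | h
  · rw [Finset.sum_Ico_eq_sub _ h]
    linarith [hf.sum_le_tsum (Finset.range M) fun n _ => hf0 n]
  · simp [Finset.Ico_eq_empty_of_le h, hε.le]

theorem summable_iff_summable_sum_Ico {g : ℕ → ℝ} (hg : ∀ m, 0 ≤ g m) {L : ℕ → ℕ}
    (hL : StrictMono L) :
    Summable g ↔ Summable fun j => ∑ m ∈ Finset.Ico (L j) (L (j + 1)), g m := by
  have hunion : ⋃ j, Ico (L j) (L (j + 1)) = Ici (L 0) :=
    iUnion_Ico_map_succ_eq_Ici (fun j => hL.monotone (Nat.zero_le j))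
      hL.not_bddAbove_range_of_wellFoundedLT
  have hcompl : (⋃ j, Ico (L j) (L (j + 1)))ᶜ.Finite := by
    rw [hunion, compl_Ici]
    exact finite_Iio _
  have hsigma : (Summable fun m : ⋃ j, Ico (L j) (L (j + 1)) => g m) ↔
      Summable fun a : Σ j, Ico (L j) (L (j + 1)) => g a.2 :=
    (unionEqSigmaOfDisjoint hL.monotone.pairwise_disjoint_on_Ico_succ).symm.summable_iff.symm
  rw [← hcompl.summable_compl_iff, compl_compl]
  refine hsigma.trans <| (summable_sigma_of_nonneg fun _ => hg _).trans <|
    (and_iff_right fun j => Summable.of_finite).trans <| summable_congr fun j => ?_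
  rw [tsum_fintype]
  exact Finset.sum_set_coe (Ico (L j) (L (j + 1))) |>.trans (by rw [toFinset_Ico])

theorem exists_residual_forall_mem_nhdsWithin {Z ι : Type*} [TopologicalSpace Z] [Countable ι]
    {A : ι → Set Z} (hA : ∀ i, @MeasurableSet Z (borel Z) (A i)) :
    ∃ R ∈ residual Z, ∀ i, ∀ x ∈ R ∩ A i, A i ∈ 𝓝[R] x := by
  borelize Z
  choose U hUo hAU using fun i => (hA i).residualEq_isOpen
  refine ⟨{x | ∀ i, x ∈ A i ↔ x ∈ U i}, eventually_countable_forall.2 fun i => (hAU i).mem_iff,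
    fun i x ⟨hxR, hxA⟩ => ?_⟩
  filter_upwards [mem_nhdsWithin_of_mem_nhds ((hUo i).mem_nhds ((hxR i).1 hxA)),
    self_mem_nhdsWithin] with y hyU hyR using (hyR i).2 hyU

theorem exists_residual_continuousOn_forall_mem_nhdsWithin {Z W ι : Type*} [TopologicalSpace Z]
    [TopologicalSpace W] [SecondCountableTopology W] [Countable ι] {θ : Z → W}
    (hθ : @Measurable Z W (borel Z) (borel W) θ) {A : ι → Set Z}
    (hA : ∀ i, @MeasurableSet Z (borel Z) (A i)) :
    ∃ R ∈ residual Z, ContinuousOn θ R ∧ ∀ i, ∀ x ∈ R ∩ A i, A i ∈ 𝓝[R] x := by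
  have hbasis := TopologicalSpace.isBasis_countableBasis W
  have := (TopologicalSpace.countable_countableBasis W).to_subtype
  let B : ι ⊕ TopologicalSpace.countableBasis W → Set Z := Sum.elim A fun b => θ ⁻¹' b
  have hB : ∀ i, @MeasurableSet Z (borel Z) (B i) := by
    borelize Z W
    exact Sum.rec hA fun b => hθ (hbasis.isOpen b.2).measurableSet
  obtain ⟨R, hR, hRB⟩ := exists_residual_forall_mem_nhdsWithin hB
  exact ⟨R, hR, fun x hx => hbasis.nhds_hasBasis.tendsto_right_iff.2 fun b ⟨hb, hxb⟩ =>
    hRB (Sum.inr ⟨b, hb⟩) x ⟨hx, hxb⟩, fun i => hRB (Sum.inl i)⟩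

section UpdateFinset

variable {ι : Type*} {E : ι → Type*} [∀ i, TopologicalSpace (E i)]

theorem continuous_updateFinset [DecidableEq ι] (s : Finset ι) (r : ∀ i : s, E i) :
    Continuous fun x : ∀ i, E i => Function.updateFinset x s r := by
  refine continuous_pi fun i => ?_
  by_cases hi : i ∈ s
  · simp only [Function.updateFinset_def, hi, dite_true, continuous_const]
  · simp only [Function.updateFinset_def, hi, dite_false, continuous_apply]

theorem isOpenMap_updateFinset [DecidableEq ι] [∀ i, DiscreteTopology (E i)] (s : Finset ι)
    (r : ∀ i : s, E i) : IsOpenMap fun x : ∀ i, E i => Function.updateFinset x s r := by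
  refine isOpenMap_iff_nhds_le.2 fun x V hV => ?_
  set w := Function.updateFinset x s r with hw
  have hrestore : Function.updateFinset w s (s.restrict x) = x := by
    funext i
    by_cases hi : i ∈ s <;> simp [hw, Function.updateFinset_def, hi]
  have hpull : ∀ᶠ y in 𝓝 w, Function.updateFinset y s (s.restrict x) ∈
      (fun x => Function.updateFinset x s r) ⁻¹' V :=
    (continuous_updateFinset s (s.restrict x)).tendsto' w x hrestore hV
  have hagree : ∀ᶠ y in 𝓝 w, ∀ i ∈ s, y i = w i :=
    (Finset.eventually_all s).2 fun i _ =>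
      (continuous_apply i).continuousAt.eventually_mem (mem_nhds_discrete.2 (mem_singleton _))
  filter_upwards [hpull, hagree] with y hyV hy
  have hyr : Function.updateFinset (Function.updateFinset y s (s.restrict x)) s r = y := by
    funext i
    by_cases hi : i ∈ s <;> simp [hy, hw, Function.updateFinset_def, hi]
  rwa [mem_preimage, hyr] at hyV

end UpdateFinset

theorem updateFinset_restrict_eq {ι : Type*} [DecidableEq ι] {E : ι → Type*} {s : Finset ι}
    {x y : ∀ i, E i} (h : ∀ i ∉ s, y i = x i) :
    Function.updateFinset x s (s.restrict y) = y := by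
  funext i
  by_cases hi : i ∈ s <;> simp [Function.updateFinset_def, hi, h]

theorem exists_forall_eventually_cofinite_eq_mem {ι : Type*} {E : ι → Type*}
    [∀ i, TopologicalSpace (E i)] [∀ i, DiscreteTopology (E i)] [∀ i, Countable (E i)]
    [∀ i, Nonempty (E i)] [Countable ι] [BaireSpace (∀ i, E i)] {H : Set (∀ i, E i)}
    (hH : H ∈ residual (∀ i, E i)) :
    ∃ z : ∀ i, E i, ∀ y, (∀ᶠ i in cofinite, y i = z i) → y ∈ H := by
  classical
  have hres : ∀ᶠ z in residual (∀ i, E i), ∀ (s : Finset ι) (r : ∀ i : s, E i),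
      Function.updateFinset z s r ∈ H :=
    eventually_countable_forall.2 fun s => eventually_countable_forall.2 fun r =>
      (tendsto_residual_of_isOpenMap (continuous_updateFinset s r)
        (isOpenMap_updateFinset s r)).eventually hH
  obtain ⟨z, hz⟩ := (dense_of_mem_residual hres).nonempty
  refine ⟨z, fun y hy => ?_⟩
  rw [← updateFinset_restrict_eq (s := (eventually_cofinite.1 hy).toFinset) (x := z) (y := y)
    (by simp)]
  exact hz _ _

section Windows

variable {E : ℕ → Type*} {Y : ℕ → Type*} [∀ m, PseudoMetricSpace (Y m)] {q : ℝ}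

/-- The sequences `x` for which the coordinates of `θ` beyond `l` almost do not change when the
first `k` entries of `x` are replaced. -/
def tailStable (q : ℝ) (θ : (∀ i, E i) → ∀ m, Y m) (k l : ℕ) : Set (∀ i, E i) :=
  {x | ∀ y y', (∀ i, k ≤ i → y i = x i) → (∀ i, k ≤ i → y' i = x i) →
    ∀ M, lpSum q (Finset.Ico l M) (θ y) (θ y') ≤ (1 / 2) ^ k}

theorem mem_tailStable_of_forall_eq {θ : (∀ i, E i) → ∀ m, Y m} {k l : ℕ} {x y : ∀ i, E i}
    (hx : x ∈ tailStable q θ k l) (hxy : ∀ i, k ≤ i → x i = y i) : y ∈ tailStable q θ k l :=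
  fun w w' hw hw' => hx w w' (fun i hi => (hw i hi).trans (hxy i hi).symm)
    fun i hi => (hw' i hi).trans (hxy i hi).symm

theorem mem_tailStable_iff_updateFinset {θ : (∀ i, E i) → ∀ m, Y m} {k l : ℕ} {x : ∀ i, E i} :
    x ∈ tailStable q θ k l ↔ ∀ (r r' : ∀ i : Finset.range k, E i) (M : ℕ),
      lpSum q (Finset.Ico l M) (θ (Function.updateFinset x (Finset.range k) r))
        (θ (Function.updateFinset x (Finset.range k) r')) ≤ (1 / 2) ^ k := by
  refine ⟨fun hx r r' => hx _ _ ?_ ?_, fun hx y y' hy hy' M => ?_⟩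
  · exact fun i hi => by simp [Function.updateFinset_def, hi]
  · exact fun i hi => by simp [Function.updateFinset_def, hi]
  · rw [← updateFinset_restrict_eq (s := Finset.range k) (y := y) (x := x) (by simpa using hy),
      ← updateFinset_restrict_eq (s := Finset.range k) (y := y') (x := x) (by simpa using hy')]
    exact hx _ _ M

theorem eventually_mem_tailStable [∀ i, Finite (E i)] {θ : (∀ i, E i) → ∀ m, Y m}
    (hθ : ∀ x y : ∀ i, E i, (∀ᶠ i in atTop, x i = y i) → lpRel Y q (θ x) (θ y))
    (k : ℕ) (x : ∀ i, E i) : ∀ᶠ l in atTop, x ∈ tailStable q θ k l := by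
  simp only [mem_tailStable_iff_updateFinset]
  refine eventually_all.2 fun r => eventually_all.2 fun r' => ?_
  refine eventually_forall_sum_Ico_le (hθ _ _ ?_) (fun _ => dist_rpow_nonneg _ _ _) (by positivity)
  filter_upwards [eventually_ge_atTop k] with i hi
  simp [Function.updateFinset_def, hi.not_gt]

/-- A generic sequence `z` with windows `[k, K k)`: for a sequence that agrees with `z` on
infinitely many windows, agreement on the `k`-th one decouples the coordinates of `θ` beyond `l k`
from the entries before `k`, and the coordinates before `l k` from the entries after `k`. -/
structure IsWindowSystem (q : ℝ) (θ : (∀ i, E i) → ∀ m, Y m) (z : ∀ i, E i) (l K : ℕ → ℕ) :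
    Prop where
  strictMono : StrictMono l
  le : ∀ k, k ≤ K k
  lpSum_Ico_le : ∀ {k x y}, (∃ᶠ j in atTop, ∀ i ∈ Ico j (K j), x i = z i) →
    (∀ i ∈ Ico k (K k), x i = z i) → (∀ i, k ≤ i → y i = x i) →
    ∀ M, lpSum q (Finset.Ico (l k) M) (θ x) (θ y) ≤ (1 / 2) ^ k
  lpSum_range_le : ∀ {k x}, (∃ᶠ j in atTop, ∀ i ∈ Ico j (K j), x i = z i) →
    (∀ i ∈ Ico k (K k), x i = z i) →
    lpSum q (Finset.range (l k)) (θ x) (θ ((Finset.range k).piecewise x z)) ≤ (1 / 2) ^ k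

variable [∀ i, TopologicalSpace (E i)]

theorem measurableSet_tailStable [∀ i, Finite (E i)] [∀ m, SecondCountableTopology (Y m)]
    {θ : (∀ i, E i) → ∀ m, Y m} (hθ : @Measurable _ _ (borel _) (borel _) θ) (k l : ℕ) :
    @MeasurableSet _ (borel _) (tailStable q θ k l) := by
  borelize (∀ i, E i) (∀ m, Y m)
  let _ : ∀ m, MeasurableSpace (Y m) := fun m => borel (Y m)
  have _ : ∀ m, BorelSpace (Y m) := fun m => ⟨rfl⟩
  have hcoord : ∀ (r : ∀ i : Finset.range k, E i) (m : ℕ),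
      Measurable fun x : ∀ i, E i => θ (Function.updateFinset x (Finset.range k) r) m := fun r m =>
    ((continuous_apply m).borel_measurable.comp hθ).comp
      (continuous_updateFinset _ r).borel_measurable
  have hset : tailStable q θ k l = ⋂ (r) (r') (M), {x |
      lpSum q (Finset.Ico l M) (θ (Function.updateFinset x (Finset.range k) r))
        (θ (Function.updateFinset x (Finset.range k) r')) ≤ (1 / 2) ^ k} := by
    ext x
    simp only [mem_tailStable_iff_updateFinset, mem_iInter, mem_ofPred_eq]
  rw [hset]
  exact MeasurableSet.iInter fun r => MeasurableSet.iInter fun r' => MeasurableSet.iInter fun M =>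
    measurableSet_le (Finset.measurable_sum _ fun m _ =>
      ((hcoord r m).dist (hcoord r' m)).pow_const q) measurable_const

variable [∀ i, DiscreteTopology (E i)] [∀ i, Finite (E i)]

theorem eventually_forall_eq_on_window {z : ∀ i, E i} {k : ℕ}
    {Q : (∀ i, E i) → (∀ i, E i) → Prop}
    (hQ : ∀ w, (∀ i, k ≤ i → w i = z i) → ∀ᶠ x in 𝓝 w, Q w x) :
    ∀ᶠ K in atTop, ∀ x, (∀ i ∈ Ico k K, x i = z i) → Q ((Finset.range k).piecewise x z) x := by
  have hev : ∀ᶠ K in atTop, ∀ (r : ∀ i : Finset.range k, E i) (x : ∀ i, E i),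
      (∀ i < K, x i = Function.updateFinset z (Finset.range k) r i) →
        Q (Function.updateFinset z (Finset.range k) r) x := by
    refine eventually_all.2 fun r => ?_
    obtain ⟨_, ⟨y, n, rfl⟩, hwy, hsub⟩ := (PiNat.isTopologicalBasis_cylinders E).mem_nhds_iff.1
      (hQ (Function.updateFinset z (Finset.range k) r)
        fun i hi => by simp [Function.updateFinset_def, hi])
    filter_upwards [eventually_ge_atTop n] with K hK x hx
    exact hsub fun i hi => (hx i (hi.trans_le hK)).trans (hwy i hi)
  filter_upwards [hev] with K hK x hx
  have hprefix : Function.updateFinset z (Finset.range k) ((Finset.range k).restrict x) =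
      (Finset.range k).piecewise x z := by
    funext i
    by_cases hi : i < k <;> simp [Function.updateFinset_def, Finset.piecewise, hi]
  rw [← hprefix]
  refine hK _ x fun i hi => ?_
  rcases lt_or_ge i k with hik | hik
  · simp [Function.updateFinset_def, hik]
  · simp [Function.updateFinset_def, hik.not_gt, hx i ⟨hik, hi⟩]

theorem exists_isWindowSystem [∀ i, Nonempty (E i)] [∀ m, SecondCountableTopology (Y m)]
    (hq : 0 < q) {θ : (∀ i, E i) → ∀ m, Y m} (hθ : @Measurable _ _ (borel _) (borel _) θ)
    (hrel : ∀ x y : ∀ i, E i, (∀ᶠ i in atTop, x i = y i) → lpRel Y q (θ x) (θ y)) :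
    ∃ z l K, IsWindowSystem q θ z l K := by
  obtain ⟨R, hR, hcont, hstable⟩ := exists_residual_continuousOn_forall_mem_nhdsWithin hθ
    fun a : ℕ × ℕ => measurableSet_tailStable (q := q) hθ a.1 a.2
  obtain ⟨H, hHR, hHG, hHd⟩ := mem_residual.1 hR
  obtain ⟨O, hOo, rfl⟩ := isGδ_iff_eq_iInter_nat.1 hHG
  obtain ⟨z, hz⟩ := exists_forall_eventually_cofinite_eq_mem
    (mem_residual.2 ⟨_, Subset.rfl, hHG, hHd⟩)
  obtain ⟨l, hl, hzl⟩ := extraction_forall_of_eventually fun k => eventually_mem_tailStable hrel k z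
  have hwindow : ∀ k, ∀ᶠ K in atTop, ∀ x, (∀ i ∈ Ico k K, x i = z i) → (∀ j < k, x ∈ O j) ∧
      (x ∈ R → x ∈ tailStable q θ k (l k) ∧
        lpSum q (Finset.range (l k)) (θ x) (θ ((Finset.range k).piecewise x z)) ≤ (1 / 2) ^ k) := by
    refine fun k => eventually_forall_eq_on_window (Q := fun w x => (∀ j < k, x ∈ O j) ∧
      (x ∈ R → x ∈ tailStable q θ k (l k) ∧
        lpSum q (Finset.range (l k)) (θ x) (θ w) ≤ (1 / 2) ^ k)) fun w hw => ?_
    have hwO : w ∈ ⋂ j, O j := hz w <| by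
      rw [Nat.cofinite_eq_atTop]
      filter_upwards [eventually_ge_atTop k] with i hi using hw i hi
    have hwR : w ∈ R := hHR hwO
    refine ((eventually_all_finite (finite_lt_nat k)).2 fun j _ =>
      (hOo j).mem_nhds (mem_iInter.1 hwO j)).and (eventually_nhdsWithin_iff.1 ?_)
    have hwl : w ∈ tailStable q θ k (l k) :=
      mem_tailStable_of_forall_eq (hzl k) fun i hi => (hw i hi).symm
    exact Eventually.and (hstable (k, l k) w ⟨hwR, hwl⟩)
      (eventually_lpSum_le_of_continuousWithinAt hq (hcont w hwR) _ (by positivity))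
  choose K hKk hK using fun k => ((eventually_ge_atTop k).and (hwindow k)).exists
  have hmem : ∀ {x}, (∃ᶠ j in atTop, ∀ i ∈ Ico j (K j), x i = z i) → x ∈ R := fun {x} hx =>
    hHR <| mem_iInter.2 fun j => by
      obtain ⟨k, hk, hjk⟩ := (hx.and_eventually (eventually_gt_atTop j)).exists
      exact (hK k x hk).1 j hjk
  exact ⟨z, l, K, hl, hKk, fun hx hxk hyx =>
    ((hK _ _ hxk).2 (hmem hx)).1 _ _ (fun _ _ => rfl) hyx,
    fun hx hxk => ((hK _ _ hxk).2 (hmem hx)).2⟩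

end Windows

section Blockwise

variable {E : ℕ → Type*} {Y : ℕ → Type*} [∀ m, PseudoMetricSpace (Y m)] {q : ℝ}

theorem lpRel_of_eventually_eq [∀ i, PseudoMetricSpace (E i)] {p : ℝ} (hp : p ≠ 0)
    {x y : ∀ i, E i} (hxy : ∀ᶠ i in atTop, x i = y i) : lpRel E p x y := by
  refine (summable_congr_cofinite (g := fun _ => (0 : ℝ)) ?_).2 summable_zero
  rw [Nat.cofinite_eq_atTop]
  filter_upwards [hxy] with i hi
  rw [hi, dist_self, Real.zero_rpow hp]

theorem exists_strictMono_forall_lt_succ {K : ℕ → ℕ} (hK : ∀ i, i ≤ K i) :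
    ∃ k : ℕ → ℕ, StrictMono k ∧ ∀ j, K (k j) < k (j + 1) := by
  let k : ℕ → ℕ := fun j => (fun i => K i + 1)^[j] 0
  have hsucc : ∀ j, K (k j) < k (j + 1) := fun j => by
    simp only [k, Function.iterate_succ_apply']
    exact Nat.lt_succ_self _
  exact ⟨k, strictMono_nat_of_lt_succ fun j => (hK _).trans_lt (hsucc j), hsucc⟩

theorem notMem_range_of_mem_Ico_of_ne {k n : ℕ → ℕ} (hk : Monotone k)
    (hn : ∀ j, n j ∈ Ico (k j) (k (j + 1))) {i j : ℕ} (hi : i ∈ Ico (k j) (k (j + 1)))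
    (hne : i ≠ n j) : i ∉ range n := by
  rintro ⟨j', rfl⟩
  obtain rfl : j' = j :=
    hk.pairwise_disjoint_on_Ico_succ.eq (not_disjoint_iff.2 ⟨_, hn j', hi⟩)
  exact hne rfl

theorem exists_extend_of_injective {ι κ : Type*} {E : ι → Type*} {n : κ → ι}
    (hn : Function.Injective n) (x : ∀ j, E (n j)) (z : ∀ i, E i) :
    ∃ a : ∀ i, E i, (∀ j, a (n j) = x j) ∧ ∀ i ∉ range n, a i = z i := by
  have hcoord : ∀ i, ∃ v : E i, (∀ j (h : n j = i), h ▸ x j = v) ∧ (i ∉ range n → v = z i) := by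
    intro i
    by_cases hi : i ∈ range n
    · obtain ⟨j, rfl⟩ := hi
      refine ⟨x j, fun j' h => ?_, fun h => absurd (mem_range_self j) h⟩
      obtain rfl := hn h
      rfl
    · exact ⟨z i, fun j h => absurd ⟨j, h⟩ hi, fun _ => rfl⟩
  choose a ha haz using hcoord
  exact ⟨a, fun j => (ha (n j) j rfl).symm, haz⟩

theorem IsWindowSystem.lpSum_block_le {θ : (∀ i, E i) → ∀ m, Y m} {z : ∀ i, E i} {l K : ℕ → ℕ}
    (hW : IsWindowSystem q θ z l K) (hq : 0 ≤ q) {k : ℕ → ℕ} (hk : StrictMono k)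
    (hKk : ∀ j, K (k j) < k (j + 1)) {a : ∀ i, E i} (ha : ∀ i ∉ range (K ∘ k), a i = z i) (j : ℕ) :
    lpSum q (Finset.Ico (l (k j)) (l (k (j + 1)))) (θ a)
      (θ (Function.update z (K (k j)) (a (K (k j))))) ≤ 2 ^ q * ((1 / 2) ^ j + (1 / 2) ^ j) := by
  have hoff : ∀ {i i'}, i ∈ Ico (k i') (k (i' + 1)) → i ≠ K (k i') → i ∉ range (K ∘ k) :=
    notMem_range_of_mem_Ico_of_ne hk.monotone fun i => ⟨hW.le _, hKk i⟩
  have hwindow : ∀ {x : ∀ i, E i}, (∀ i ∉ range (K ∘ k), x i = z i) →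
      ∀ i', ∀ i ∈ Ico (k i') (K (k i')), x i = z i := fun hx i' i hi =>
    hx i (hoff ⟨hi.1, hi.2.trans (hKk i')⟩ hi.2.ne)
  have hfreq : ∀ {x : ∀ i, E i}, (∀ i ∉ range (K ∘ k), x i = z i) →
      ∃ᶠ i' in atTop, ∀ i ∈ Ico i' (K i'), x i = z i := fun hx =>
    hk.tendsto_atTop.frequently (Frequently.of_forall (hwindow hx))
  set b := (Finset.range (k (j + 1))).piecewise a z with hb
  set c := Function.update z (K (k j)) (a (K (k j))) with hc
  have hcz : ∀ i ∉ range (K ∘ k), c i = z i := fun i hi =>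
    Function.update_of_ne (fun h => hi ⟨j, h.symm⟩) _ _
  have hbc : ∀ i, k j ≤ i → b i = c i := fun i hi => by
    rcases eq_or_ne i (K (k j)) with rfl | hne
    · simp [hb, hc, hKk j]
    by_cases hlt : i < k (j + 1)
    · simp [hb, hc, hne, Finset.piecewise, ha i (hoff ⟨hi, hlt⟩ hne)]
    · simp [hb, hc, hne, hlt]
  have hpow : ∀ {i}, j ≤ i → (1 / 2 : ℝ) ^ i ≤ (1 / 2) ^ j :=
    pow_le_pow_of_le_one (by norm_num) (by norm_num)
  have hhead : lpSum q (Finset.Ico (l (k j)) (l (k (j + 1)))) (θ a) (θ b) ≤ (1 / 2) ^ j :=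
    (lpSum_mono (fun m hm => Finset.mem_range.2 (Finset.mem_Ico.1 hm).2) _ _).trans <|
      (hW.lpSum_range_le (hfreq ha) (hwindow ha (j + 1))).trans
        (hpow (j.le_succ.trans (hk.le_apply)))
  have htail : lpSum q (Finset.Ico (l (k j)) (l (k (j + 1)))) (θ b) (θ c) ≤ (1 / 2) ^ j := by
    rw [lpSum_comm]
    exact (hW.lpSum_Ico_le (hfreq hcz) (hwindow hcz j) hbc _).trans (hpow hk.le_apply)
  refine (lpSum_le_two_rpow_mul_add hq _ _ (θ b) _).trans ?_
  gcongr

theorem exists_blockwise_of_borelReducible [∀ i, PseudoMetricSpace (E i)]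
    [∀ i, DiscreteTopology (E i)] [∀ i, Finite (E i)] [∀ i, Nonempty (E i)]
    [∀ m, SecondCountableTopology (Y m)] {p : ℝ} (hp : p ≠ 0) (hq : 0 < q)
    (h : BorelReducible (lpRel E p) (lpRel Y q)) :
    ∃ (n : ℕ → ℕ) (s : ℕ → Finset ℕ) (T : ∀ j, E (n j) → ∀ m, Y m), StrictMono n ∧
      ∀ x y, lpRel (fun j => E (n j)) p x y ↔
        Summable fun j => lpSum q (s j) (T j (x j)) (T j (y j)) := by
  obtain ⟨θ, hθ, hred⟩ := h
  obtain ⟨z, l, K, hW⟩ := exists_isWindowSystem hq hθ fun x y hxy => (hred x y).1 <|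
    lpRel_of_eventually_eq hp hxy
  obtain ⟨k, hk, hKk⟩ := exists_strictMono_forall_lt_succ hW.le
  have hn : StrictMono (K ∘ k) := strictMono_nat_of_lt_succ fun j => (hKk j).trans_le (hW.le _)
  let s : ℕ → Finset ℕ := fun j => Finset.Ico (l (k j)) (l (k (j + 1)))
  let T : ∀ j, E (K (k j)) → ∀ m, Y m := fun j u => θ (Function.update z (K (k j)) u)
  have hblock : ∀ {a}, (∀ i ∉ range (K ∘ k), a i = z i) →
      Summable fun j => lpSum q (s j) (θ a) (T j (a (K (k j)))) := fun ha =>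
    ((summable_geometric_two.add summable_geometric_two).mul_left (2 ^ q)).of_nonneg_of_le
      (fun j => lpSum_nonneg _ _ _) (hW.lpSum_block_le hq.le hk hKk ha)
  refine ⟨K ∘ k, s, T, hn, fun x y => ?_⟩
  obtain ⟨a, hax, haz⟩ := exists_extend_of_injective hn.injective x z
  obtain ⟨b, hby, hbz⟩ := exists_extend_of_injective hn.injective y z
  obtain rfl : (fun j => a (K (k j))) = x := funext hax
  obtain rfl : (fun j => b (K (k j))) = y := funext hby
  have hoff : ∀ i ∉ range (K ∘ k), dist (a i) (b i) ^ p = 0 := fun i hi => by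
    rw [haz i hi, hbz i hi, dist_self, Real.zero_rpow hp]
  calc lpRel (fun j => E (K (k j))) p (fun j => a (K (k j))) (fun j => b (K (k j)))
      ↔ lpRel E p a b := hn.injective.summable_iff hoff
    _ ↔ lpRel Y q (θ a) (θ b) := hred a b
    _ ↔ Summable fun j => lpSum q (s j) (θ a) (θ b) :=
        summable_iff_summable_sum_Ico (fun _ => dist_rpow_nonneg _ _ _) (hW.strictMono.comp hk)
    _ ↔ Summable fun j => lpSum q (s j) (T j (a (K (k j)))) (T j (b (K (k j)))) := ?_
  have ha := hblock haz
  have hb := hblock hbz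
  have ha' := ha.congr fun j => lpSum_comm (s j) _ _
  have hb' := hb.congr fun j => lpSum_comm (s j) _ _
  exact ⟨fun h => summable_lpSum_trans hq.le ha' (summable_lpSum_trans hq.le h hb),
    fun h => summable_lpSum_trans hq.le ha (summable_lpSum_trans hq.le h hb')⟩

end Blockwise

theorem exists_injective_forall_of_frequently {κ : Type*} [Countable κ] {P : κ → ℕ → Prop}
    (hP : ∀ a, ∃ᶠ j in atTop, P a j) : ∃ e : κ → ℕ, Function.Injective e ∧ ∀ a, P a (e a) := by
  obtain ⟨code, hcode⟩ := exists_injective_nat κ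
  have hfreq : ∀ n, ∃ᶠ j in atTop, ∀ a, code a = n → P a j := by
    intro n
    by_cases hn : n ∈ range code
    · obtain ⟨a, rfl⟩ := hn
      exact (hP a).mono fun j hj b hb => hcode hb ▸ hj
    · exact Frequently.of_forall fun j a ha => absurd ⟨a, ha⟩ hn
  obtain ⟨φ, hφ, hPφ⟩ := extraction_forall_of_frequently hfreq
  exact ⟨φ ∘ code, hφ.injective.comp hcode, fun a => hPφ (code a) a rfl⟩

theorem extend_apply_mem {κ ι X : Type*} {V : ι → Set X} {e : κ → ι} (he : Function.Injective e)
    {t : κ → X} (ht : ∀ a, t a ∈ V (e a)) {w : ι → X} (hw : ∀ j, w j ∈ V j) (j : ι) :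
    Function.extend e t w j ∈ V j := by
  by_cases hj : ∃ a, e a = j
  · obtain ⟨a, rfl⟩ := hj
    rw [he.extend_apply]
    exact ht a
  · rw [Function.extend_apply' _ _ _ hj]
    exact hw j

section SigmaFin

variable {M : ℕ → ℕ} {φ : (Σ k, Fin (M k)) → ℝ}

theorem summable_sigma_fin_of_mul_le (hM : ∀ k, 0 < M k) (hφ : ∀ a, 0 ≤ φ a) {c : ℕ → ℝ}
    (hc : Summable c) (hφc : ∀ a, M a.1 * φ a ≤ c a.1) : Summable φ := by
  refine (summable_sigma_of_nonneg hφ).2 ⟨fun k => .of_finite, ?_⟩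
  refine hc.of_nonneg_of_le (fun k => tsum_nonneg fun i => hφ _) fun k => ?_
  have hMk : 0 < (M k : ℝ) := Nat.cast_pos.2 (hM k)
  rw [tsum_fintype]
  calc ∑ i, φ ⟨k, i⟩ ≤ Finset.univ.card • (c k / M k) :=
        Finset.sum_le_card_nsmul _ _ _ fun i _ => (le_div_iff₀' hMk).2 (hφc ⟨k, i⟩)
    _ = c k := by
        rw [Finset.card_univ, Fintype.card_fin, nsmul_eq_mul, mul_div_cancel₀ _ hMk.ne']

theorem exists_mul_lt_one_of_summable_sigma_fin (hM : ∀ k, 0 < M k) (hφ : ∀ a, 0 ≤ φ a)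
    (hsum : Summable φ) : ∃ a, M a.1 * φ a < 1 := by
  by_contra! hlarge
  have htail := ((summable_sigma_of_nonneg hφ).1 hsum).2.tendsto_atTop_zero
  obtain ⟨k, hk⟩ := (htail.eventually (gt_mem_nhds one_pos)).exists
  have hMk : 0 < (M k : ℝ) := Nat.cast_pos.2 (hM k)
  refine hk.not_ge ?_
  rw [tsum_fintype]
  calc (1 : ℝ) = Finset.univ.card • (1 / (M k : ℝ)) := by
        rw [Finset.card_univ, Fintype.card_fin, nsmul_eq_mul, mul_one_div_cancel hMk.ne']
    _ ≤ ∑ i, φ ⟨k, i⟩ :=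
        Finset.card_nsmul_le_sum _ _ _ fun i _ => (div_le_iff₀' hMk).2 (hlarge ⟨k, i⟩)

end SigmaFin

section SummablyControls

variable {X : Type*} {V : ℕ → Set X}

/-- Summability of `g j (x j) (y j)` implies that of `h j (x j) (y j)`, for all sequences `x`, `y`
through the sets `V j`. -/
def SummablyControls (V : ℕ → Set X) (g h : ℕ → X → X → ℝ) : Prop :=
  ∀ x y : ℕ → X, (∀ j, x j ∈ V j) → (∀ j, y j ∈ V j) →
    (Summable fun j => g j (x j) (y j)) → Summable fun j => h j (x j) (y j)

-- Otherwise, using each pair `(u k, v k)` on `M k` coordinates, all distinct, makes the `g`-sum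
-- at most `∑ c k` while each `k` contributes at least `1` to the `h`-sum.
theorem SummablyControls.exists_eventually_lt_one {g h : ℕ → X → X → ℝ}
    (hgh : SummablyControls V g h) (hV : ∀ j, (V j).Nonempty) (hg : ∀ j u v, 0 ≤ g j u v)
    (hg_self : ∀ j u, g j u u = 0) (hh : ∀ j u v, 0 ≤ h j u v) {u v : ℕ → X}
    (hu : ∀ k, u k ∈ liminf V atTop) (hv : ∀ k, v k ∈ liminf V atTop) (M : ℕ → ℕ) {c : ℕ → ℝ}
    (hc : Summable c) :
    ∃ k, ∀ᶠ j in atTop, M k * g j (u k) (v k) ≤ c k → M k * h j (u k) (v k) < 1 := by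
  by_contra! hfreq
  have hfreq' : ∀ a : Σ k, Fin (M k), ∃ᶠ j in atTop,
      (M a.1 * g j (u a.1) (v a.1) ≤ c a.1 ∧ 1 ≤ M a.1 * h j (u a.1) (v a.1)) ∧
        u a.1 ∈ V j ∧ v a.1 ∈ V j := fun a =>
    (hfreq a.1).and_eventually
      ((mem_liminf_iff_eventually_mem.1 (hu a.1)).and (mem_liminf_iff_eventually_mem.1 (hv a.1)))
  obtain ⟨e, he, hP⟩ := exists_injective_forall_of_frequently hfreq'
  choose w hw using hV
  have hM : ∀ k, 0 < M k := fun k => Nat.pos_of_ne_zero fun h0 => by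
    obtain ⟨j, -, hj⟩ := (hfreq k).exists
    rw [h0, Nat.cast_zero, zero_mul] at hj
    exact hj.not_gt one_pos
  let x := Function.extend e (fun a => u a.1) w
  let y := Function.extend e (fun a => v a.1) w
  have hx : ∀ a, x (e a) = u a.1 := he.extend_apply _ _
  have hy : ∀ a, y (e a) = v a.1 := he.extend_apply _ _
  have hgsum : Summable fun j => g j (x j) (y j) := by
    rw [← he.summable_iff fun j hj => by
      simp only [x, y, Function.extend_apply' _ _ _ hj, hg_self]]
    refine summable_sigma_fin_of_mul_le hM (fun a => hg _ _ _) hc fun a => ?_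
    rw [Function.comp_apply, hx, hy]
    exact (hP a).1.1
  have hhsum := hgh x y (extend_apply_mem he (fun a => (hP a).2.1) hw)
    (extend_apply_mem he (fun a => (hP a).2.2) hw) hgsum
  obtain ⟨a, ha⟩ :=
    exists_mul_lt_one_of_summable_sigma_fin hM (fun a => hh _ _ _) (hhsum.comp_injective he)
  rw [hx, hy] at ha
  exact ha.not_ge (hP a).1.2

variable {p C : ℝ} {f : ℕ → X → X → ℝ}

theorem SummablyControls.exists_min_dist_rpow_le [PseudoMetricSpace X]
    (hctrl : SummablyControls V f fun _ u v => dist u v ^ p) (hV : ∀ j, (V j).Nonempty)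
    (hp : 0 ≤ p) (hC : 0 ≤ C) (hf : ∀ j u v, 0 ≤ f j u v) (hf_self : ∀ j u, f j u u = 0) :
    ∃ B, ∀ u ∈ liminf V atTop, ∀ v ∈ liminf V atTop,
      ∀ᶠ j in atTop, min (dist u v) C ^ p ≤ B * f j u v := by
  have hmin : ∀ u v : X, 0 ≤ min (dist u v) C := fun u v => le_min dist_nonneg hC
  have hctrl' : SummablyControls V f fun _ u v => min (dist u v) C ^ p := fun x y hx hy hs =>
    (hctrl x y hx hy hs).of_nonneg_of_le (fun _ => Real.rpow_nonneg (hmin _ _) _) fun _ =>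
      Real.rpow_le_rpow (hmin _ _) (min_le_left _ _) hp
  by_contra! hB
  choose u hu v hv hfreq using fun k : ℕ => hB (2 ^ k)
  set t : ℕ → ℝ := fun k => min (dist (u k) (v k)) C ^ p
  have htC : ∀ k, t k ≤ C ^ p := fun k => Real.rpow_le_rpow (hmin _ _) (min_le_right _ _) hp
  obtain ⟨k, hk⟩ := hctrl'.exists_eventually_lt_one hV hf hf_self
    (fun _ _ _ => Real.rpow_nonneg (hmin _ _) _) hu hv (fun k => ⌈1 / t k⌉₊)
    (summable_geometric_two.mul_right (1 + C ^ p))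
  obtain ⟨j, hlt, hsmall⟩ := ((hfreq k).and_eventually hk).exists
  have htk : 0 < t k := (mul_nonneg (by positivity) (hf _ _ _)).trans_lt hlt
  refine (hsmall ?_).not_ge ((div_le_iff₀ htk).1 (Nat.le_ceil _))
  have hfk : f j (u k) (v k) ≤ (1 / 2) ^ k * t k := by
    rw [one_div, inv_pow, inv_mul_eq_div, le_div_iff₀' (by positivity)]
    exact hlt.le
  calc (⌈1 / t k⌉₊ : ℝ) * f j (u k) (v k) ≤ (1 / t k + 1) * ((1 / 2) ^ k * t k) := by
        gcongr
        · exact hf _ _ _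
        · exact (Nat.ceil_lt_add_one (by positivity)).le
    _ = (1 / 2) ^ k * (1 + t k) := by field_simp
    _ ≤ (1 / 2) ^ k * (1 + C ^ p) := by gcongr; exact htC k

theorem SummablyControls.exists_le_mul_dist_rpow_of_dist_lt [MetricSpace X]
    (hctrl : SummablyControls V (fun _ u v => dist u v ^ p) f) (hV : ∀ j, (V j).Nonempty)
    (hp : 0 < p) (hf : ∀ j u v, 0 ≤ f j u v) (hf_self : ∀ j u, f j u u = 0) :
    ∃ B, ∃ ε > 0, ∀ u ∈ liminf V atTop, ∀ v ∈ liminf V atTop, dist u v < ε →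
      ∀ᶠ j in atTop, f j u v ≤ B * dist u v ^ p := by
  by_contra! hB
  choose u hu v hv hd hfreq using fun k : ℕ => hB (4 ^ k) (((1 / 2) ^ k) ^ p⁻¹) (by positivity)
  set t : ℕ → ℝ := fun k => dist (u k) (v k) ^ p
  obtain ⟨k, hk⟩ := hctrl.exists_eventually_lt_one hV (fun _ _ _ => dist_rpow_nonneg _ _ _)
    (fun _ _ => by rw [dist_self, Real.zero_rpow hp.ne']) hf hu hv
    (fun k => ⌈(1 / 2) ^ k / t k⌉₊) (summable_geometric_two.add summable_geometric_two)
  obtain ⟨j, hlt, hlarge⟩ := ((hfreq k).and_eventually hk).exists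
  have htk : 0 < t k := by
    refine Real.rpow_pos_of_pos (dist_pos.2 fun h => hlt.not_ge ?_) _
    rw [h, hf_self]
    exact mul_nonneg (by positivity) (dist_rpow_nonneg _ _ _)
  have htk_le : t k ≤ (1 / 2) ^ k :=
    (Real.le_rpow_inv_iff_of_pos dist_nonneg (by positivity) hp).1 (hd k).le
  refine (hlarge ?_).not_ge ?_
  · calc (⌈(1 / 2) ^ k / t k⌉₊ : ℝ) * t k ≤ ((1 / 2) ^ k / t k + 1) * t k := by
          gcongr
          exact (Nat.ceil_lt_add_one (by positivity)).le
      _ = (1 / 2) ^ k + t k := by field_simp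
      _ ≤ (1 / 2) ^ k + (1 / 2) ^ k := by gcongr
  · calc (1 : ℝ) ≤ 2 ^ k := one_le_pow₀ one_le_two
      _ = (1 / 2) ^ k / t k * (4 ^ k * t k) := by
          field_simp
          rw [← mul_pow]
          norm_num
      _ ≤ ⌈(1 / 2) ^ k / t k⌉₊ * f j (u k) (v k) := by
          gcongr
          exact Nat.le_ceil _

theorem Link.exists_chain_mem_dense [PseudoMetricSpace X] (hlink : Link X C) {D : Set X}
    (hD : Dense D) {ε : ℝ} (hε : 0 < ε) :
    ∃ N, ∀ u ∈ D, ∀ v ∈ D, dist u v < C → ∃ r : ℕ → X, (∀ i, r i ∈ D) ∧ r 0 = u ∧ r N = v ∧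
      ∀ i < N, dist (r i) (r (i + 1)) < ε := by
  obtain ⟨N, -, hN⟩ := hlink (ε / 3) (by positivity)
  refine ⟨N, fun u hu v hv huv => ?_⟩
  obtain ⟨r, hr0, hrN, hr⟩ := hN u v huv
  have happrox : ∀ x, ∃ d ∈ D, dist x d < ε / 3 ∧ (x ∈ D → d = x) := fun x => by
    by_cases hx : x ∈ D
    · exact ⟨x, hx, by rw [dist_self]; positivity, fun _ => rfl⟩
    · obtain ⟨d, hd, hxd⟩ := hD.exists_dist_lt x (ε := ε / 3) (by positivity)
      exact ⟨d, hd, hxd, fun h => absurd h hx⟩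
  choose d hdD hd hd_self using happrox
  refine ⟨fun i => d (r i), fun i => hdD _, (congrArg d hr0).trans (hd_self _ hu),
    (congrArg d hrN).trans (hd_self _ hv), fun i hi => ?_⟩
  calc dist (d (r i)) (d (r (i + 1)))
      ≤ dist (d (r i)) (r i) + dist (r i) (r (i + 1)) + dist (r (i + 1)) (d (r (i + 1))) :=
        dist_triangle4 _ _ _ _
    _ < ε / 3 + ε / 3 + ε / 3 :=
        add_lt_add (add_lt_add (dist_comm (r i) _ ▸ hd _) (hr i hi)) (hd _)
    _ = ε := add_thirds ε

theorem Link.exists_eventually_le_of_dist_lt [PseudoMetricSpace X] (hlink : Link X C) {D : Set X}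
    (hD : Dense D) {Q K ε : ℝ} (hQ : 0 ≤ Q) (hε : 0 < ε) (hf_self : ∀ j u, f j u u = 0)
    (hf_trans : ∀ j u v w, f j u w ≤ Q * (f j u v + f j v w))
    (hK : ∀ u ∈ D, ∀ v ∈ D, dist u v < ε → ∀ᶠ j in atTop, f j u v ≤ K) :
    ∃ B, ∀ u ∈ D, ∀ v ∈ D, dist u v < C → ∀ᶠ j in atTop, f j u v ≤ B := by
  obtain ⟨N, hN⟩ := hlink.exists_chain_mem_dense hD hε
  refine ⟨(fun b => Q * (b + K))^[N] 0, fun u hu v hv huv => ?_⟩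
  obtain ⟨r, hrD, hr0, hrN, hr⟩ := hN u hu v hv huv
  have hprefix : ∀ i ≤ N, ∀ᶠ j in atTop, f j u (r i) ≤ (fun b => Q * (b + K))^[i] 0 := by
    intro i
    induction i with
    | zero => exact fun _ => Eventually.of_forall fun j => by rw [hr0, hf_self]; rfl
    | succ i ih =>
      intro hi
      filter_upwards [ih (Nat.le_of_succ_le hi), hK _ (hrD i) _ (hrD (i + 1)) (hr i hi)]
        with j hfirst hlast
      rw [Function.iterate_succ_apply']
      exact (hf_trans j u (r i) _).trans (mul_le_mul_of_nonneg_left (add_le_add hfirst hlast) hQ)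
  simpa only [hrN] using hprefix N le_rfl

theorem SummablyControls.exists_le_mul_dist_rpow [MetricSpace X]
    (hctrl : SummablyControls V (fun _ u v => dist u v ^ p) f) (hV : ∀ j, (V j).Nonempty)
    (hVD : Dense (liminf V atTop)) (hlink : Link X C) (hp : 0 < p) {Q : ℝ} (hQ : 0 ≤ Q)
    (hf : ∀ j u v, 0 ≤ f j u v) (hf_self : ∀ j u, f j u u = 0)
    (hf_trans : ∀ j u v w, f j u w ≤ Q * (f j u v + f j v w)) :
    ∃ B, ∀ u ∈ liminf V atTop, ∀ v ∈ liminf V atTop, dist u v < C →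
      ∀ᶠ j in atTop, f j u v ≤ B * dist u v ^ p := by
  obtain ⟨B₁, ε, hε, hB₁⟩ := hctrl.exists_le_mul_dist_rpow_of_dist_lt hV hp hf hf_self
  obtain ⟨B₂, hB₂⟩ := hlink.exists_eventually_le_of_dist_lt (K := |B₁| * ε ^ p) hVD hQ hε hf_self
    hf_trans fun u hu v hv huv => (hB₁ u hu v hv huv).mono fun j hj => hj.trans <| by
      gcongr
      exact le_abs_self B₁
  refine ⟨max B₁ (|B₂| / ε ^ p), fun u hu v hv huv => ?_⟩
  rcases lt_or_ge (dist u v) ε with hlt | hge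
  · exact (hB₁ u hu v hv hlt).mono fun j hj => hj.trans <| by
      gcongr
      exact le_max_left _ _
  · filter_upwards [hB₂ u hu v hv huv] with j hj
    calc f j u v ≤ |B₂| := hj.trans (le_abs_self _)
      _ = |B₂| / ε ^ p * ε ^ p := (div_mul_cancel₀ _ (by positivity)).symm
      _ ≤ max B₁ (|B₂| / ε ^ p) * dist u v ^ p := by
          gcongr
          exact le_max_right _ _

theorem SummablyControls.exists_eventually_comparable [MetricSpace X]
    (hctrl : SummablyControls V (fun _ u v => dist u v ^ p) f)
    (hctrl' : SummablyControls V f fun _ u v => dist u v ^ p) (hV : ∀ j, (V j).Nonempty)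
    (hVD : Dense (liminf V atTop)) (hlink : Link X C) (hp : 0 < p) (hC : 0 < C) {Q : ℝ}
    (hQ : 0 ≤ Q) (hf : ∀ j u v, 0 ≤ f j u v) (hf_self : ∀ j u, f j u u = 0)
    (hf_trans : ∀ j u v w, f j u w ≤ Q * (f j u v + f j v w)) :
    ∃ A D : ℝ, 0 < A ∧ 0 < D ∧ ∀ u ∈ liminf V atTop, ∀ v ∈ liminf V atTop, ∀ᶠ j in atTop,
      (C ≤ dist u v → D ≤ f j u v) ∧
        (dist u v < C → dist u v ^ p ≤ A * f j u v ∧ f j u v ≤ A * dist u v ^ p) := by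
  obtain ⟨B, hB⟩ := hctrl.exists_le_mul_dist_rpow hV hVD hlink hp hQ hf hf_self hf_trans
  obtain ⟨B', hB'⟩ := hctrl'.exists_min_dist_rpow_le hV hp.le hC.le hf hf_self
  set A := max 1 (max B B')
  have hA0 : 0 < A := one_pos.trans_le (le_max_left _ _)
  have hBA : B ≤ A := (le_max_left _ _).trans (le_max_right _ _)
  have hBA' : B' ≤ A := (le_max_right _ _).trans (le_max_right _ _)
  refine ⟨A, C ^ p / A, hA0, by positivity, fun u hu v hv => ?_⟩
  have hupper : ∀ᶠ j in atTop, dist u v < C → f j u v ≤ A * dist u v ^ p :=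
    eventually_imp_distrib_left.2 fun huv => (hB u hu v hv huv).mono fun j hj => hj.trans <| by
      gcongr
  filter_upwards [hB' u hu v hv, hupper] with j hlower hupper
  have hlower : min (dist u v) C ^ p ≤ A * f j u v :=
    hlower.trans (mul_le_mul_of_nonneg_right hBA' (hf _ _ _))
  refine ⟨fun huv => ?_, fun huv => ⟨?_, hupper huv⟩⟩
  · rw [div_le_iff₀' hA0]
    rwa [min_eq_right huv] at hlower
  · rwa [min_eq_left huv.le] at hlower

end SummablyControls

section LqSpace

variable {Y : ℕ → Type*} [∀ n, PseudoMetricSpace (Y n)] {q : ℝ}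

theorem hasSum_dist_piecewise_rpow (hq : q ≠ 0) (s : Finset ℕ) (x y z : ∀ n, Y n) :
    HasSum (fun n => dist (s.piecewise x z n) (s.piecewise y z n) ^ q) (lpSum q s x y) := by
  have hin : lpSum q s x y = ∑ n ∈ s, dist (s.piecewise x z n) (s.piecewise y z n) ^ q :=
    Finset.sum_congr rfl fun n hn => by
      rw [Finset.piecewise_eq_of_mem _ _ _ hn, Finset.piecewise_eq_of_mem _ _ _ hn]
  rw [hin]
  exact hasSum_sum_of_ne_finset_zero fun n hn => by
    rw [Finset.piecewise_eq_of_notMem _ _ _ hn, Finset.piecewise_eq_of_notMem _ _ _ hn, dist_self,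
      Real.zero_rpow hq]

variable {ystar : ∀ n, Y n} [hq : Fact (1 ≤ q)]

theorem LqSpace.dist_rpow (x y : LqSpace Y ystar q) :
    dist x y ^ q = ∑' n, dist (x.1 n) (y.1 n) ^ q := by
  change ((∑' n, dist (x.1 n) (y.1 n) ^ q) ^ (1 / q)) ^ q = _
  rw [one_div, Real.rpow_inv_rpow (tsum_nonneg fun n => dist_rpow_nonneg _ _ _)
    (one_pos.trans_le hq.out).ne']

variable (q ystar) in
/-- The point of `ℓ_q(Y, y*)` that agrees with `y` on the finite set `s` and with `y*` off it. -/
noncomputable def LqSpace.ofFinset (s : Finset ℕ) (y : ∀ n, Y n) : LqSpace Y ystar q :=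
  ⟨s.piecewise y ystar, by
    simpa only [Finset.piecewise_idem_right, Finset.piecewise_same] using
      (hasSum_dist_piecewise_rpow (one_pos.trans_le hq.out).ne' s y ystar ystar).summable⟩

theorem LqSpace.dist_ofFinset_rpow (s : Finset ℕ) (x y : ∀ n, Y n) :
    dist (ofFinset q ystar s x) (ofFinset q ystar s y) ^ q = lpSum q s x y := by
  rw [LqSpace.dist_rpow]
  exact (hasSum_dist_piecewise_rpow (one_pos.trans_le hq.out).ne' s x y ystar).tsum_eq

end LqSpace

section HolderExponent

variable {p q A d t : ℝ}

theorem inv_mul_rpow_div_le_iff (hq : 0 < q) (hA : 0 < A) (hd : 0 ≤ d) (ht : 0 ≤ t) :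
    A⁻¹ * d ^ (p / q) ≤ t ↔ d ^ p ≤ A ^ q * t ^ q := by
  rw [inv_mul_le_iff₀ hA, ← Real.rpow_le_rpow_iff (by positivity) (by positivity) hq,
    Real.mul_rpow hA.le ht, ← Real.rpow_mul hd, div_mul_cancel₀ _ hq.ne']

theorem le_mul_rpow_div_iff (hq : 0 < q) (hA : 0 < A) (hd : 0 ≤ d) (ht : 0 ≤ t) :
    t ≤ A * d ^ (p / q) ↔ t ^ q ≤ A ^ q * d ^ p := by
  rw [← Real.rpow_le_rpow_iff ht (by positivity) hq, Real.mul_rpow hA.le (by positivity),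
    ← Real.rpow_mul hd, div_mul_cancel₀ _ hq.ne']

theorem finitelyHolderEmbeds_div_iff {X X' : Type*} [PseudoMetricSpace X] [PseudoMetricSpace X']
    {C : ℝ} (hq : 0 < q) :
    FinitelyHolderEmbeds X X' C (p / q) ↔
      ∃ A D : ℝ, 0 < A ∧ 0 < D ∧ ∀ F : Set X, F.Finite → ∃ T : F → X', ∀ u v : F,
        (C ≤ dist u v → D ≤ dist (T u) (T v) ^ q) ∧
          (dist u v < C → dist u v ^ p ≤ A * dist (T u) (T v) ^ q ∧
            dist (T u) (T v) ^ q ≤ A * dist u v ^ p) := by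
  constructor
  · rintro ⟨A, D, hA, hD, h⟩
    refine ⟨A ^ q, D ^ q, by positivity, by positivity, fun F hF => ?_⟩
    obtain ⟨T, hT⟩ := h F hF
    refine ⟨T, fun u v => ⟨fun huv => ?_, fun huv => ?_⟩⟩
    · exact Real.rpow_le_rpow hD.le ((hT u v).1 huv) hq.le
    · rw [← inv_mul_rpow_div_le_iff hq hA dist_nonneg dist_nonneg,
        ← le_mul_rpow_div_iff hq hA dist_nonneg dist_nonneg]
      exact (hT u v).2 huv
  · rintro ⟨A, D, hA, hD, h⟩
    refine ⟨A ^ q⁻¹, D ^ q⁻¹, by positivity, by positivity, fun F hF => ?_⟩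
    obtain ⟨T, hT⟩ := h F hF
    refine ⟨T, fun u v => ⟨fun huv => ?_, fun huv => ?_⟩⟩
    · exact (Real.rpow_inv_le_iff_of_pos hD.le dist_nonneg hq).2 ((hT u v).1 huv)
    · rw [inv_mul_rpow_div_le_iff hq (by positivity) dist_nonneg dist_nonneg,
        le_mul_rpow_div_iff hq (by positivity) dist_nonneg dist_nonneg,
        Real.rpow_inv_rpow hA.le hq.ne']
      exact (hT u v).2 huv

end HolderExponent

section FiniteExhaustion

variable {Z : Type*} [TopologicalSpace Z] {G : ℕ → Set Z}

theorem IsFiniteExhaustion.nonempty_apply (hG : IsFiniteExhaustion G) (n : ℕ) : (G n).Nonempty :=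
  hG.nonempty.mono (hG.mono (Nat.zero_le n))

theorem IsFiniteExhaustion.iUnion_subset_liminf (hG : IsFiniteExhaustion G) {n : ℕ → ℕ}
    (hn : Tendsto n atTop atTop) : ⋃ i, G i ⊆ liminf (fun j => G (n j)) atTop :=
  iUnion_subset fun i _ hu => mem_liminf_iff_eventually_mem.2 <|
    (hn.eventually_ge_atTop i).mono fun _ hj => hG.mono hj hu

end FiniteExhaustion

section Approximation

theorem eventually_comparable_of_tendsto {g : ℕ → ℝ} {σ : ℝ} (hg : Tendsto g atTop (𝓝 σ))
    (hσ : 0 ≤ σ) (hzero : σ = 0 → ∀ m, g m = 0) :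
    ∀ᶠ m in atTop, σ ≤ 2 * g m ∧ g m ≤ 2 * σ := by
  rcases hσ.eq_or_lt' with rfl | hpos
  · exact Eventually.of_forall fun m => by simp [hzero rfl m]
  · filter_upwards [hg.eventually (le_mem_nhds (half_lt_self hpos)),
      hg.eventually (ge_mem_nhds (lt_two_mul_self hpos))] with m hlower hupper
    exact ⟨by linarith, hupper⟩

variable {Z ι : Type*} [PseudoMetricSpace Z] {G : ℕ → Set Z}

theorem IsFiniteExhaustion.secondCountableTopology (hG : IsFiniteExhaustion G) :
    SecondCountableTopology Z :=
  have : TopologicalSpace.SeparableSpace Z :=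
    ⟨⋃ n, G n, countable_iUnion fun n => (hG.finite n).countable, hG.dense⟩
  UniformSpace.secondCountable_of_separable Z

-- Choosing `g z m` through the function `dist · z` alone gives points at distance `0` the same
-- sequence, so that vanishing distances stay exactly `0`.
theorem IsFiniteExhaustion.exists_forall_tendsto (hG : IsFiniteExhaustion G) :
    ∃ g : Z → ℕ → Z, (∀ z m, g z m ∈ G m) ∧ (∀ z, Tendsto (g z) atTop (𝓝 z)) ∧
      ∀ z w, dist z w = 0 → g z = g w := by
  choose nearest hmem hmin using fun (δ : Z → ℝ) m =>
    exists_min_image (G m) δ (hG.finite m) (hG.nonempty_apply m)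
  refine ⟨fun z => nearest fun w => dist w z, fun z => hmem _, fun z => ?_, fun z w hzw => ?_⟩
  · refine Metric.tendsto_atTop.2 fun ε hε => ?_
    obtain ⟨w, hw, hwz⟩ := hG.dense.exists_dist_lt z hε
    obtain ⟨n, hn⟩ := mem_iUnion.1 hw
    rw [dist_comm] at hwz
    exact ⟨n, fun m hm => (hmin (dist · z) m w (hG.mono hm hn)).trans_lt hwz⟩
  · refine congrArg nearest (funext fun a => ?_)
    linarith [dist_triangle_right a z w, dist_triangle a z w, dist_triangle a w z, dist_comm z w]

theorem IsFiniteExhaustion.exists_dist_comparable [Finite ι] (hG : IsFiniteExhaustion G)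
    (a : ι → Z) (C : ℝ) :
    ∃ b : ι → Z, (∀ i, b i ∈ ⋃ n, G n) ∧ ∀ i j, dist (a i) (a j) ≤ 2 * dist (b i) (b j) ∧
      dist (b i) (b j) ≤ 2 * dist (a i) (a j) ∧ (dist (a i) (a j) < C → dist (b i) (b j) < C) := by
  obtain ⟨g, hmem, hlim, hzero⟩ := hG.exists_forall_tendsto
  have hdist : ∀ z w, Tendsto (fun m => dist (g z m) (g w m)) atTop (𝓝 (dist z w)) := fun z w =>
    (hlim z).dist (hlim w)
  have hpair : ∀ᶠ m in atTop, ∀ i j, (dist (a i) (a j) ≤ 2 * dist (g (a i) m) (g (a j) m) ∧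
      dist (g (a i) m) (g (a j) m) ≤ 2 * dist (a i) (a j)) ∧
        (dist (a i) (a j) < C → dist (g (a i) m) (g (a j) m) < C) :=
    eventually_all.2 fun i => eventually_all.2 fun j =>
      (eventually_comparable_of_tendsto (hdist _ _) dist_nonneg fun h m => by
        rw [hzero _ _ h, dist_self]).and <|
      eventually_imp_distrib_left.2 fun h => (hdist _ _).eventually (gt_mem_nhds h)
  obtain ⟨m, hm⟩ := hpair.exists
  exact ⟨fun i => g (a i) m, fun i => mem_iUnion_of_mem m (hmem _ _), fun i j =>
    ⟨(hm i j).1.1, (hm i j).1.2, (hm i j).2⟩⟩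

end Approximation

section Forward

variable {X : Type*} [MetricSpace X] {Y : ℕ → Type*} [∀ m, PseudoMetricSpace (Y m)] {p q C : ℝ}
  {F : ℕ → Set X}

theorem exists_eventually_lpSum_comparable_of_borelReducible [∀ m, SecondCountableTopology (Y m)]
    [∀ m, Nonempty (Y m)] (hp : 0 < p) (hq : 0 < q) (hC : 0 < C) (hX : Link X C)
    (hF : IsFiniteExhaustion F) (h : BorelReducible (finRel F p) (lpRel Y q)) :
    ∃ (s : ℕ → Finset ℕ) (T : ℕ → X → ∀ m, Y m) (A D : ℝ), 0 < A ∧ 0 < D ∧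
      ∀ u ∈ ⋃ n, F n, ∀ v ∈ ⋃ n, F n, ∀ᶠ j in atTop,
        (C ≤ dist u v → D ≤ lpSum q (s j) (T j u) (T j v)) ∧
          (dist u v < C → dist u v ^ p ≤ A * lpSum q (s j) (T j u) (T j v) ∧
            lpSum q (s j) (T j u) (T j v) ≤ A * dist u v ^ p) := by
  have _ : ∀ i, Finite (F i) := fun i => (hF.finite i).to_subtype
  have _ : ∀ i, Nonempty (F i) := fun i => (hF.nonempty_apply i).to_subtype
  obtain ⟨n, s, T, hn, hT⟩ := exists_blockwise_of_borelReducible hp.ne' hq h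
  let T' : ℕ → X → ∀ m, Y m := fun j =>
    Function.extend Subtype.val (T j) fun _ _ => Classical.arbitrary _
  have hT' : ∀ j (u : F (n j)), T' j u = T j u := fun j u =>
    Subtype.val_injective.extend_apply _ _ u
  have hred : ∀ x y : ℕ → X, (∀ j, x j ∈ F (n j)) → (∀ j, y j ∈ F (n j)) →
      ((Summable fun j => dist (x j) (y j) ^ p) ↔
        Summable fun j => lpSum q (s j) (T' j (x j)) (T' j (y j))) := fun x y hx hy => by
    have hTxy := hT (fun j => ⟨x j, hx j⟩) fun j => ⟨y j, hy j⟩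
    simp only [← hT'] at hTxy
    exact hTxy
  have hsub := hF.iUnion_subset_liminf hn.tendsto_atTop
  obtain ⟨A, D, hA, hD, hAD⟩ := SummablyControls.exists_eventually_comparable
    (V := fun j => F (n j)) (f := fun j u v => lpSum q (s j) (T' j u) (T' j v))
    (fun x y hx hy => (hred x y hx hy).1)
    (fun x y hx hy => (hred x y hx hy).2) (fun j => hF.nonempty_apply _) (hF.dense.mono hsub)
    hX hp hC (Q := 2 ^ q) (by positivity) (fun j u v => lpSum_nonneg _ _ _)
    (fun j u => lpSum_self hq.ne' _ _) fun j u v w => lpSum_le_two_rpow_mul_add hq.le _ _ _ _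
  exact ⟨s, T', A, D, hA, hD, fun u hu v hv => hAD u (hsub hu) v (hsub hv)⟩

theorem finitelyHolderEmbeds_of_borelReducible [∀ m, SecondCountableTopology (Y m)]
    [hq : Fact (1 ≤ q)] (hp : 0 < p) (hC : 0 < C) (hX : Link X C) (hF : IsFiniteExhaustion F)
    (h : BorelReducible (finRel F p) (lpRel Y q)) (ystar : ∀ m, Y m) :
    FinitelyHolderEmbeds X (LqSpace Y ystar q) C (p / q) := by
  have hq0 : 0 < q := one_pos.trans_le hq.out
  have _ : ∀ m, Nonempty (Y m) := fun m => ⟨ystar m⟩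
  obtain ⟨s, T, A, D, hA, hD, hT⟩ :=
    exists_eventually_lpSum_comparable_of_borelReducible hp hq0 hC hX hF h
  rw [finitelyHolderEmbeds_div_iff hq0]
  refine ⟨2 ^ p * A, min D ((C / 2) ^ p / A), by positivity, by positivity, fun P hP => ?_⟩
  have _ : Finite P := hP.to_subtype
  obtain ⟨b, hbF, hb⟩ := hF.exists_dist_comparable ((↑) : P → X) C
  obtain ⟨j, hj⟩ := (eventually_all.2 fun u => eventually_all.2 fun v =>
    hT (b u) (hbF u) (b v) (hbF v)).exists
  refine ⟨fun u => .ofFinset q ystar (s j) (T j (b u)), fun u v => ?_⟩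
  obtain ⟨hle, hge, hlt⟩ := hb u v
  obtain ⟨hfar, hnear⟩ := hj u v
  rw [LqSpace.dist_ofFinset_rpow, Subtype.dist_eq]
  refine ⟨fun huv => min_le_iff.2 ?_, fun huv => ⟨?_, ?_⟩⟩
  · refine (le_or_gt C (dist (b u) (b v))).imp hfar fun hlt => ?_
    rw [div_le_iff₀' hA]
    refine (Real.rpow_le_rpow (by positivity) ?_ hp.le).trans (hnear hlt).1
    linarith
  · calc dist (u : X) v ^ p ≤ (2 * dist (b u) (b v)) ^ p :=
          Real.rpow_le_rpow dist_nonneg hle hp.le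
      _ = 2 ^ p * dist (b u) (b v) ^ p := Real.mul_rpow zero_le_two dist_nonneg
      _ ≤ 2 ^ p * (A * lpSum q (s j) (T j (b u)) (T j (b v))) := by
          gcongr
          exact (hnear (hlt huv)).1
      _ = 2 ^ p * A * lpSum q (s j) (T j (b u)) (T j (b v)) := (mul_assoc _ _ _).symm
  · calc lpSum q (s j) (T j (b u)) (T j (b v)) ≤ A * dist (b u) (b v) ^ p := (hnear (hlt huv)).2
      _ ≤ A * (2 * dist (u : X) v) ^ p := by gcongr
      _ = 2 ^ p * A * dist (u : X) v ^ p := by rw [Real.mul_rpow zero_le_two dist_nonneg]; ring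

end Forward

section Converse

variable {Y : Type*} [PseudoMetricSpace Y] {G : ℕ → Set Y} {p q : ℝ}

theorem IsFiniteExhaustion.exists_tsum_dist_rpow_comparable {ι : Type*} [Finite ι]
    (hG : IsFiniteExhaustion G) (hq : 0 < q) (T : ι → ℕ → Y)
    (hT : ∀ u v, Summable fun i => dist (T u i) (T v i) ^ q) :
    ∃ (m : ℕ) (S : ι → ℕ → Y), (∀ u i, S u i ∈ G m) ∧
      ∀ u v, (Summable fun i => dist (S u i) (S v i) ^ q) ∧
        ∑' i, dist (T u i) (T v i) ^ q ≤ 4 * ∑' i, dist (S u i) (S v i) ^ q ∧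
        ∑' i, dist (S u i) (S v i) ^ q ≤ 4 * ∑' i, dist (T u i) (T v i) ^ q := by
  obtain ⟨g, hgG, hg, hzero⟩ := hG.exists_forall_tendsto
  obtain ⟨y₀, hy₀⟩ := hG.nonempty
  have h0 : ∀ u v i, 0 ≤ dist (T u i) (T v i) ^ q := fun u v i => dist_rpow_nonneg _ _ _
  have htrunc : ∀ᶠ K in atTop, ∀ u v,
      ∑' i, dist (T u i) (T v i) ^ q ≤ 2 * lpSum q (Finset.range K) (T u) (T v) ∧
        lpSum q (Finset.range K) (T u) (T v) ≤ 2 * ∑' i, dist (T u i) (T v i) ^ q :=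
    eventually_all.2 fun u => eventually_all.2 fun v =>
      eventually_comparable_of_tendsto (hT u v).hasSum.tendsto_sum_nat (tsum_nonneg (h0 u v))
        fun hσ K => Finset.sum_eq_zero fun i _ =>
          (((hT u v).le_tsum i fun i _ => h0 u v i).trans_eq hσ).antisymm (h0 u v i)
  obtain ⟨K, hK⟩ := htrunc.exists
  have hselect : ∀ᶠ m in atTop, ∀ u v,
      lpSum q (Finset.range K) (T u) (T v) ≤
          2 * lpSum q (Finset.range K) (fun i => g (T u i) m) (fun i => g (T v i) m) ∧
        lpSum q (Finset.range K) (fun i => g (T u i) m) (fun i => g (T v i) m) ≤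
          2 * lpSum q (Finset.range K) (T u) (T v) := by
    refine eventually_all.2 fun u => eventually_all.2 fun v =>
      eventually_comparable_of_tendsto (tendsto_finsetSum _ fun i _ =>
        ((hg _).dist (hg _)).rpow_const (Or.inr hq.le)) (lpSum_nonneg _ _ _) fun hσ m =>
          Finset.sum_eq_zero fun i hi => ?_
    have hi := (Finset.sum_eq_zero_iff_of_nonneg fun i _ => h0 u v i).1 hσ i hi
    simp only [hzero _ _ ((Real.rpow_eq_zero dist_nonneg hq.ne').1 hi), dist_self,
      Real.zero_rpow hq.ne']
  obtain ⟨m, hm⟩ := hselect.exists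
  refine ⟨m, fun u => (Finset.range K).piecewise (fun i => g (T u i) m) fun _ => y₀,
    fun u i => ?_, fun u v => ?_⟩
  · exact (Finset.range K).piecewise_cases (fun i => g (T u i) m) (fun _ => y₀) (· ∈ G m) (hgG _ _)
      (hG.mono (Nat.zero_le m) hy₀)
  · have hS := hasSum_dist_piecewise_rpow hq.ne' (Finset.range K) (fun i => g (T u i) m)
      (fun i => g (T v i) m) fun _ => y₀
    rw [hS.tsum_eq]
    exact ⟨hS.summable, by linarith [hK u v, hm u v], by linarith [hK u v, hm u v]⟩

theorem IsFiniteExhaustion.exists_continuous_finRel_iff_summable_tsum {E : ℕ → Type*}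
    [∀ n, TopologicalSpace (E n)] [∀ n, DiscreteTopology (E n)] (hG : IsFiniteExhaustion G)
    (hq : q ≠ 0) {m : ℕ → ℕ} {S : ∀ n, E n → ℕ → Y} (hSG : ∀ n u i, S n u i ∈ G (m n))
    (hS : ∀ n u v, Summable fun i => dist (S n u i) (S n v i) ^ q) :
    ∃ θ : (∀ n, E n) → ∀ j, G j, Continuous θ ∧ ∀ x y, finRel G q (θ x) (θ y) ↔
      Summable fun n => ∑' i, dist (S n (x n) i) (S n (y n) i) ^ q := by
  obtain ⟨y₀, hy₀⟩ := hG.nonempty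
  obtain ⟨e, he, hme⟩ := exists_injective_forall_of_frequently (P := fun (a : ℕ × ℕ) j => m a.1 ≤ j)
    fun a => (eventually_ge_atTop (m a.1)).frequently
  let θ : (∀ n, E n) → ℕ → Y := fun x =>
    Function.extend e (fun a => S a.1 (x a.1) a.2) fun _ => y₀
  have hθ : ∀ x a, θ x (e a) = S a.1 (x a.1) a.2 := fun x a => he.extend_apply _ _ _
  have hθ_off : ∀ x, ∀ j ∉ range e, θ x j = y₀ := fun x j hj => Function.extend_apply' _ _ _ hj
  have hθG : ∀ x j, θ x j ∈ G j := fun x =>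
    extend_apply_mem he (fun a => hG.mono (hme a) (hSG _ _ _)) fun j => hG.mono (Nat.zero_le j) hy₀
  refine ⟨fun x j => ⟨θ x j, hθG x j⟩, continuous_pi fun j => Continuous.subtype_mk ?_ _,
    fun x y => ?_⟩
  · by_cases hj : j ∈ range e
    · obtain ⟨a, rfl⟩ := hj
      simp only [hθ]
      exact (continuous_of_discreteTopology (f := fun u : E a.1 => S a.1 u a.2)).comp
        (continuous_apply a.1)
    · simp only [hθ_off _ j hj]
      exact continuous_const
  · calc finRel G q (fun j => ⟨θ x j, hθG x j⟩) (fun j => ⟨θ y j, hθG y j⟩)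
        ↔ Summable fun j => dist (θ x j) (θ y j) ^ q := Iff.rfl
      _ ↔ Summable fun a => dist (θ x (e a)) (θ y (e a)) ^ q :=
          (he.summable_iff fun j hj => by
            rw [hθ_off x j hj, hθ_off y j hj, dist_self, Real.zero_rpow hq]).symm
      _ ↔ Summable fun a : ℕ × ℕ => dist (S a.1 (x a.1) a.2) (S a.1 (y a.1) a.2) ^ q := by
          simp only [hθ]
      _ ↔ Summable fun n => ∑' i, dist (S n (x n) i) (S n (y n) i) ^ q :=
          (summable_prod_of_nonneg fun a =>
            dist_rpow_nonneg (S a.1 (x a.1) a.2) (S a.1 (y a.1) a.2) q).trans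
              (and_iff_right fun n => hS n (x n) (y n))

theorem summable_rpow_iff_of_comparable {d t : ℕ → ℝ} {A C D : ℝ} (hp : 0 < p) (hC : 0 < C)
    (hD : 0 < D) (hd : ∀ n, 0 ≤ d n) (ht : ∀ n, 0 ≤ t n) (hfar : ∀ n, C ≤ d n → D ≤ t n)
    (hnear : ∀ n, d n < C → d n ^ p ≤ A * t n ∧ t n ≤ A * d n ^ p) :
    (Summable fun n => d n ^ p) ↔ Summable t := by
  constructor
  · intro hsum
    refine .of_norm_bounded_eventually_nat (hsum.mul_left A) ?_
    filter_upwards [hsum.tendsto_atTop_zero.eventually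
      (gt_mem_nhds (Real.rpow_pos_of_pos hC p))] with n hn
    rw [Real.norm_of_nonneg (ht n)]
    exact (hnear n ((Real.rpow_lt_rpow_iff (hd n) hC.le hp).1 hn)).2
  · intro hsum
    refine .of_norm_bounded_eventually_nat (hsum.mul_left A) ?_
    filter_upwards [hsum.tendsto_atTop_zero.eventually (gt_mem_nhds hD)] with n hn
    rw [Real.norm_of_nonneg (Real.rpow_nonneg (hd n) p)]
    exact (hnear n (lt_of_not_ge fun h => (hfar n h).not_gt hn)).1

theorem borelReducible_of_finitelyHolderEmbeds {X : Type*} [MetricSpace X] {C : ℝ}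
    {F : ℕ → Set X} {ystar : ℕ → Y} [hq : Fact (1 ≤ q)] (hp : 0 < p) (hC : 0 < C)
    (hF : ∀ n, (F n).Finite) (hG : IsFiniteExhaustion G)
    (h : FinitelyHolderEmbeds X (LqSpace (fun _ => Y) ystar q) C (p / q)) :
    BorelReducible (finRel F p) (finRel G q) := by
  have hq0 : 0 < q := one_pos.trans_le hq.out
  obtain ⟨A, D, hA, hD, h⟩ := (finitelyHolderEmbeds_div_iff hq0).1 h
  choose T hT using fun n => h (F n) (hF n)
  simp only [LqSpace.dist_rpow] at hT
  have _ : ∀ n, Finite (F n) := fun n => (hF n).to_subtype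
  choose m S hSG hS hTS hST using fun n => hG.exists_tsum_dist_rpow_comparable hq0
    (fun u => (T n u).1) fun u v => LqSpace.summable_dist hq.out (T n u) (T n v)
  obtain ⟨θ, hθ, hred⟩ := hG.exists_continuous_finRel_iff_summable_tsum hq0.ne' hSG hS
  refine ⟨θ, hθ.borel_measurable, fun x y => Iff.trans ?_ (hred x y).symm⟩
  refine summable_rpow_iff_of_comparable (A := 4 * A) hp hC (by positivity : 0 < D / 4)
    (fun n => dist_nonneg) (fun n => tsum_nonneg fun i => dist_rpow_nonneg _ _ _)
    (fun n hn => ?_) fun n hn => ⟨?_, ?_⟩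
  · linarith [(hT n (x n) (y n)).1 hn, hTS n (x n) (y n)]
  · nlinarith [((hT n (x n) (y n)).2 hn).1, hTS n (x n) (y n)]
  · linarith [((hT n (x n) (y n)).2 hn).2, hST n (x n) (y n)]

theorem BorelReducible.of_finRel {Z : Type*} [TopologicalSpace Z] {R : Z → Z → Prop}
    (h : BorelReducible R (finRel G q)) : BorelReducible R (lpRel (fun _ : ℕ => Y) q) := by
  obtain ⟨θ, hθ, hred⟩ := h
  have hval : Continuous fun (x : ∀ n, G n) (n : ℕ) => (x n : Y) :=
    continuous_pi fun n => continuous_subtype_val.comp (continuous_apply n)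
  borelize Z (∀ n, G n) (ℕ → Y)
  exact ⟨fun x n => θ x n, hval.borel_measurable.comp hθ, hred⟩

end Converse

theorem mainTheorem6_general {X Y : Type*} [MetricSpace X] [PseudoMetricSpace Y] {p q : ℝ}
    (hp : 0 < p) [Fact (1 ≤ q)] {C : ℝ} (hC : 0 < C) (hX : Link X C) {F : ℕ → Set X}
    (hF : IsFiniteExhaustion F) {G : ℕ → Set Y} (hG : IsFiniteExhaustion G) :
    List.TFAE [
      ∃ ystar : ℕ → Y, FinitelyHolderEmbeds X (LqSpace (fun _ => Y) ystar q) C (p / q),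
      BorelReducible (finRel F p) (lpRel (fun _ => Y) q),
      BorelReducible (finRel F p) (finRel G q)] := by
  have _ : SecondCountableTopology Y := hG.secondCountableTopology
  obtain ⟨y₀, -⟩ := hG.nonempty
  tfae_have 1 → 3 := fun ⟨_, h⟩ => borelReducible_of_finitelyHolderEmbeds hp hC hF.finite hG h
  tfae_have 3 → 2 := BorelReducible.of_finRel
  tfae_have 2 → 1 := fun h =>
    ⟨fun _ => y₀, finitelyHolderEmbeds_of_borelReducible hp hC hX hF h _⟩
  tfae_finish

theorem mainTheorem6 {X Y : Type*}
    [MetricSpace X] [CompleteSpace X] [TopologicalSpace.SeparableSpace X]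
    [MetricSpace Y] [CompleteSpace Y] [TopologicalSpace.SeparableSpace Y]
    (p q : ℝ) (hp : 1 ≤ p) [hq : Fact (1 ≤ q)]
    (C : ℝ) (hC : 0 < C) (hX : Link X C)
    (F : ℕ → Set X) (hF : IsFiniteExhaustion F)
    (G : ℕ → Set Y) (hG : IsFiniteExhaustion G) :
    List.TFAE [
      ∃ ystar : ℕ → Y, FinitelyHolderEmbeds X (LqSpace (fun _ => Y) ystar q) C (p / q),
      BorelReducible (finRel F p) (lpRel (fun _ => Y) q),
      BorelReducible (finRel F p) (finRel G q)] :=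
  mainTheorem6_general (one_pos.trans_le hp) hC hX hF hG
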